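/- Let $k\ge 1$ be an integer and let $\mathbb G=(\mathcal V,\mathcal E)$ be the regular rooted tree with $k$-fold branching: a tree in which the root $0$ has $k$ neighbours and every other vertex has $k+1$ neighbours. Write $w\sim v$ when $v,w$ are joined by an edge, and let $|v|$ be the graph distance from $0$ to $v$. On $\ell^2(\mathcal V)$ (complex-valued functions) let $(L\phi)(v)=\sum_{w\sim v}\phi(w)$, let $d_0(v)=1$ if $v$ is the root and $d_0(v)=0$ otherwise, and for a bounded function $M:\mathcal V\to\mathbb C$ (acting by multiplication) put $$\widetilde M:=-d_0+M,\qquad -\Delta_{\widetilde M}:=-L+k+1+\widetilde M ,$$ so that $(-\Delta_{\widetilde M}\phi)(v)=-\sum_{w\sim v}(\phi(w)-\phi(v))+M(v)\phi(v)$. Let $t_\pm(k):=\pm2\sqrt k+k+1$. Assume (Assumption (A)) that there are constants $C$ and $\delta$, with $\delta>0$ if $k=1$ and $\delta\ge 6\ln k$ if $k\ge2$, such that $|M(v)|\le C e^{-\delta|v|}$ for all $v\in\mathcal V$; $M$ need not be real-valued. Then there is no sequence $(\nu_j)_{j\in\mathbb N}$ of (real or non-real) eigenvalues of $-\Delta_{\widetilde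 M}$ that accumulates at $t_-(k)$, and none that accumulates at $t_+(k)$. Here a sequence accumulates at $t$ if every neighbourhood of $t$ contains a term $\nu_j\neq t$, and an eigenvalue is a $z\in\mathbb C$ with $-\Delta_{\widetilde M}\phi=z\phi$ for some nonzero $\phi\in\ell^2(\mathcal V)$. -/

import Mathlib

open Filter Topology
open scoped ENNReal

namespace RegularTree

universe u

/-- `G` is a regular tree graph with `k`-fold branching rooted at `o`: a tree in which the root has
`k` neighbours (its children) and each other vertex has `k + 1` (its parent and `k` children). -/
structure IsRegularRootedTree {V : Type u} (G : SimpleGraph V) [G.LocallyFinite] (o : V) (k : ℕ) :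
    Prop where
  isTree : G.IsTree
  degree_root : G.degree o = k
  degree_of_ne : ∀ v, v ≠ o → G.degree v = k + 1

/-- The Hilbert space `ℓ²(V)` of square-summable complex functions on `V`. -/
abbrev L2 (V : Type u) : Type u := lp (fun _ : V => ℂ) 2

section Operators

variable {V : Type u}

theorem memL2_of_sum_le {f : V → ℂ} {C : ℝ}
    (h : ∀ s : Finset V, ∑ v ∈ s, ‖f v‖ ^ 2 ≤ C) : Memℓp f (2 : ℝ≥0∞) := by
  refine memℓp_gen' (C := C) fun s => ?_
  simpa using h s

theorem norm_le_of_sum_le {f : L2 V} {C : ℝ} (hC : 0 ≤ C)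
    (h : ∀ s : Finset V, ∑ v ∈ s, ‖f v‖ ^ 2 ≤ C ^ 2) : ‖f‖ ≤ C := by
  refine lp.norm_le_of_forall_sum_le (by norm_num) hC fun s => ?_
  simpa using h s

theorem sum_sq_le_norm_sq (f : L2 V) (s : Finset V) : ∑ v ∈ s, ‖f v‖ ^ 2 ≤ ‖f‖ ^ 2 := by
  simpa using lp.sum_rpow_le_norm_rpow (p := 2) (by norm_num) f s

theorem sum_sq_mul_le (m : V → ℂ) {C : ℝ} (hm : ∀ v, ‖m v‖ ≤ C) (f : L2 V) (s : Finset V) :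
    ∑ v ∈ s, ‖m v * f v‖ ^ 2 ≤ (|C| * ‖f‖) ^ 2 := by
  calc ∑ v ∈ s, ‖m v * f v‖ ^ 2 ≤ ∑ v ∈ s, |C| ^ 2 * ‖f v‖ ^ 2 := by
        refine Finset.sum_le_sum fun v _ => ?_
        rw [norm_mul, mul_pow]
        gcongr
        exact (hm v).trans (le_abs_self C)
    _ = |C| ^ 2 * ∑ v ∈ s, ‖f v‖ ^ 2 := by rw [Finset.mul_sum]
    _ ≤ |C| ^ 2 * ‖f‖ ^ 2 := by gcongr; exact sum_sq_le_norm_sq f s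
    _ = (|C| * ‖f‖) ^ 2 := by rw [mul_pow]

theorem sum_sq_adj_le (G : SimpleGraph V) [G.LocallyFinite] {D : ℕ} (hD : ∀ v, G.degree v ≤ D)
    (f : L2 V) (s : Finset V) :
    ∑ v ∈ s, ‖∑ w ∈ G.neighborFinset v, f w‖ ^ 2 ≤ ((D : ℝ) * ‖f‖) ^ 2 := by
  classical
  have h1 : ∀ v, ‖∑ w ∈ G.neighborFinset v, f w‖ ^ 2 ≤
      (D : ℝ) * ∑ w ∈ G.neighborFinset v, ‖f w‖ ^ 2 := by
    intro v
    calc ‖∑ w ∈ G.neighborFinset v, f w‖ ^ 2 ≤ (∑ w ∈ G.neighborFinset v, ‖f w‖) ^ 2 := by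
          gcongr; exact norm_sum_le _ _
      _ ≤ ((G.neighborFinset v).card : ℝ) * ∑ w ∈ G.neighborFinset v, ‖f w‖ ^ 2 :=
          sq_sum_le_card_mul_sum_sq
      _ ≤ (D : ℝ) * ∑ w ∈ G.neighborFinset v, ‖f w‖ ^ 2 := by
          gcongr; exact hD v
  have h2 : ∑ v ∈ s, ∑ w ∈ G.neighborFinset v, ‖f w‖ ^ 2 ≤ (D : ℝ) * ‖f‖ ^ 2 := by
    set t := s.biUnion fun v => G.neighborFinset v with ht
    have h3 : ∑ v ∈ s, ∑ w ∈ G.neighborFinset v, ‖f w‖ ^ 2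
        = ∑ w ∈ t, ∑ v ∈ s.filter (fun v => G.Adj w v), ‖f w‖ ^ 2 := by
      refine Finset.sum_comm' fun v w => ?_
      simp only [SimpleGraph.mem_neighborFinset, Finset.mem_filter, ht, Finset.mem_biUnion]
      constructor
      · rintro ⟨hv, hvw⟩
        exact ⟨⟨hv, hvw.symm⟩, v, hv, hvw⟩
      · rintro ⟨⟨hv, hvw⟩, -⟩
        exact ⟨hv, hvw.symm⟩
    rw [h3]
    calc ∑ w ∈ t, ∑ v ∈ s.filter (fun v => G.Adj w v), ‖f w‖ ^ 2
        ≤ ∑ w ∈ t, (D : ℝ) * ‖f w‖ ^ 2 := by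
          refine Finset.sum_le_sum fun w _ => ?_
          rw [Finset.sum_const, nsmul_eq_mul]
          gcongr
          refine le_trans (Finset.card_le_card ?_) (hD w)
          intro v hv
          simpa using (Finset.mem_filter.1 hv).2
      _ = (D : ℝ) * ∑ w ∈ t, ‖f w‖ ^ 2 := by rw [Finset.mul_sum]
      _ ≤ (D : ℝ) * ‖f‖ ^ 2 := by gcongr; exact sum_sq_le_norm_sq f t
  calc ∑ v ∈ s, ‖∑ w ∈ G.neighborFinset v, f w‖ ^ 2
      ≤ ∑ v ∈ s, (D : ℝ) * ∑ w ∈ G.neighborFinset v, ‖f w‖ ^ 2 :=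
        Finset.sum_le_sum fun v _ => h1 v
    _ = (D : ℝ) * ∑ v ∈ s, ∑ w ∈ G.neighborFinset v, ‖f w‖ ^ 2 := by rw [Finset.mul_sum]
    _ ≤ (D : ℝ) * ((D : ℝ) * ‖f‖ ^ 2) := by gcongr
    _ = ((D : ℝ) * ‖f‖) ^ 2 := by ring

/-- Multiplication by a bounded function `m`, as a bounded operator on `ℓ²(V)`. -/
noncomputable def mulOp (m : V → ℂ) (hm : ∃ C : ℝ, ∀ v, ‖m v‖ ≤ C) : L2 V →L[ℂ] L2 V :=
  LinearMap.mkContinuousOfExistsBound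
    { toFun := fun f => ⟨fun v => m v * f v, memL2_of_sum_le (sum_sq_mul_le m hm.choose_spec f)⟩
      map_add' := fun f g => by ext v; exact mul_add _ _ _
      map_smul' := fun c f => by ext v; simp [mul_left_comm] }
    ⟨|hm.choose|, fun f => norm_le_of_sum_le (by positivity) (sum_sq_mul_le m hm.choose_spec f)⟩

@[simp] theorem mulOp_apply (m : V → ℂ) (hm : ∃ C : ℝ, ∀ v, ‖m v‖ ≤ C) (f : L2 V) (v : V) :
    mulOp m hm f v = m v * f v := rfl

/-- The operator `(L φ)(v) = ∑_{w ∼ v} φ(w)`, as a bounded operator on `ℓ²(V)`, for a graph with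
bounded vertex degrees. -/
noncomputable def adjOp (G : SimpleGraph V) [G.LocallyFinite] (hG : ∃ D : ℕ, ∀ v, G.degree v ≤ D) :
    L2 V →L[ℂ] L2 V :=
  LinearMap.mkContinuousOfExistsBound
    { toFun := fun f => ⟨fun v => ∑ w ∈ G.neighborFinset v, f w,
        memL2_of_sum_le (sum_sq_adj_le G hG.choose_spec f)⟩
      map_add' := fun f g => by ext v; exact Finset.sum_add_distrib
      map_smul' := fun c f => by ext v; simp [Finset.mul_sum] }
    ⟨(hG.choose : ℝ), fun f =>
      norm_le_of_sum_le (by positivity) (sum_sq_adj_le G hG.choose_spec f)⟩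

@[simp] theorem adjOp_apply (G : SimpleGraph V) [G.LocallyFinite]
    (hG : ∃ D : ℕ, ∀ v, G.degree v ≤ D) (f : L2 V) (v : V) :
    adjOp G hG f v = ∑ w ∈ G.neighborFinset v, f w := rfl

end Operators

section Model

variable {V : Type u}

theorem IsRegularRootedTree.degree_bdd {G : SimpleGraph V} [G.LocallyFinite] {o : V} {k : ℕ}
    (hG : IsRegularRootedTree G o k) : ∃ D : ℕ, ∀ v, G.degree v ≤ D := by
  refine ⟨k + 1, fun v => ?_⟩
  by_cases hv : v = o
  · subst hv
    rw [hG.degree_root]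
    omega
  · rw [hG.degree_of_ne v hv]

/-- The exponential decay assumption on the potential, `|v|` being the graph distance to `o`. -/
def DecayAssumption (G : SimpleGraph V) (o : V) (k : ℕ) (M : V → ℂ) : Prop :=
  ∃ C δ : ℝ, (if k = 1 then 0 < δ else 6 * Real.log k ≤ δ) ∧
    ∀ v, ‖M v‖ ≤ C * Real.exp (-δ * (G.dist o v : ℝ))

open Classical in
/-- The function equal to `1` at the root `o` and to `0` elsewhere. -/
noncomputable def rootIndicator (o : V) (v : V) : ℂ := if v = o then 1 else 0

/-- The modified potential `M̃ = -d₀ + M`. -/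
noncomputable def modifiedPotential (o : V) (M : V → ℂ) (v : V) : ℂ := -rootIndicator o v + M v

theorem DecayAssumption.bdd {G : SimpleGraph V} {o : V} {k : ℕ} {M : V → ℂ}
    (hM : DecayAssumption G o k M) : ∃ C : ℝ, ∀ v, ‖M v‖ ≤ C := by
  obtain ⟨C, δ, hδ, h⟩ := hM
  have hδ0 : 0 ≤ δ := by
    split_ifs at hδ with hk
    · exact hδ.le
    · exact le_trans (mul_nonneg (by norm_num) (Real.log_natCast_nonneg k)) hδ
  refine ⟨|C|, fun v => (h v).trans ?_⟩
  have h1 : Real.exp (-δ * (G.dist o v : ℝ)) ≤ 1 := by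
    rw [Real.exp_le_one_iff]
    have : 0 ≤ δ * (G.dist o v : ℝ) := by positivity
    linarith
  calc C * Real.exp (-δ * (G.dist o v : ℝ)) ≤ |C| * Real.exp (-δ * (G.dist o v : ℝ)) := by
        gcongr; exact le_abs_self C
    _ ≤ |C| * 1 := by gcongr
    _ = |C| := mul_one _

theorem modifiedPotential_bdd (o : V) {M : V → ℂ} (hM : ∃ C : ℝ, ∀ v, ‖M v‖ ≤ C) :
    ∃ C : ℝ, ∀ v, ‖modifiedPotential o M v‖ ≤ C := by
  obtain ⟨C, hC⟩ := hM
  refine ⟨1 + C, fun v => ?_⟩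
  refine (norm_add_le _ _).trans (add_le_add ?_ (hC v))
  rw [norm_neg, rootIndicator]
  split_ifs <;> simp

/-- The operator `-L + k + 1 + M̃` on `ℓ²(V)`, for a bounded potential `M`. -/
noncomputable def schrodinger {G : SimpleGraph V} [G.LocallyFinite] {o : V} {k : ℕ}
    (hG : IsRegularRootedTree G o k) (M : V → ℂ) (hM : ∃ C : ℝ, ∀ v, ‖M v‖ ≤ C) :
    L2 V →L[ℂ] L2 V :=
  -adjOp G hG.degree_bdd + ((k : ℂ) + 1) • ContinuousLinearMap.id ℂ (L2 V) +
    mulOp (modifiedPotential o M) (modifiedPotential_bdd o hM)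

/-- The operator above is the graph Laplacian plus the potential `M`. -/
theorem schrodinger_apply {G : SimpleGraph V} [G.LocallyFinite] {o : V} {k : ℕ}
    (hG : IsRegularRootedTree G o k) (M : V → ℂ) (hM : ∃ C : ℝ, ∀ v, ‖M v‖ ≤ C) (f : L2 V)
    (v : V) :
    schrodinger hG M hM f v = -∑ w ∈ G.neighborFinset v, (f w - f v) + M v * f v := by
  have hdeg : (G.degree v : ℂ) = (k : ℂ) + 1 - rootIndicator o v := by
    rw [rootIndicator]
    split_ifs with h
    · subst h
      rw [hG.degree_root]
      ring
    · rw [hG.degree_of_ne v h]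
      push_cast
      ring
  have h1 : schrodinger hG M hM f v = -(∑ w ∈ G.neighborFinset v, f w) + ((k : ℂ) + 1) * f v +
      modifiedPotential o M v * f v := rfl
  rw [h1, Finset.sum_sub_distrib, Finset.sum_const, nsmul_eq_mul,
    SimpleGraph.card_neighborFinset_eq_degree, hdeg, modifiedPotential]
  ring

/-- The lower threshold `t₋(k) = -2√k + k + 1`. -/
noncomputable def tMinus (k : ℕ) : ℝ := -2 * Real.sqrt k + k + 1

/-- The upper threshold `t₊(k) = 2√k + k + 1`. -/
noncomputable def tPlus (k : ℕ) : ℝ := 2 * Real.sqrt k + k + 1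

/-- `z` is an eigenvalue of the bounded operator `T`: `T φ = z φ` for some nonzero `φ ∈ ℓ²(V)`. -/
def IsEigenvalue (T : L2 V →L[ℂ] L2 V) (z : ℂ) : Prop :=
  Module.End.HasEigenvalue (T : Module.End ℂ (L2 V)) z

/-- The sequence of points `ν` accumulates at `t`: each neighbourhood of `t` contains terms of the
sequence different from `t`. -/
def AccumulatesAt (ν : ℕ → ℂ) (t : ℂ) : Prop := AccPt t (𝓟 (Set.range ν))

end Model

end RegularTree

/-! Write the spectral parameter as `z = k + 1 - lam` with `lam * s = k * s ^ 2 + 1`. The equation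
in `s` has roots with product `1 / k`, so `s` can be taken in the disc `‖s‖ ^ 2 * k ≤ 1`; the
thresholds correspond to the double roots `s = ±1/√k`. In the variable `s` they are no longer
singular. Let `P φ = φ ∘ par` off the root, `P φ = 0` at the root, and let `P*` be the sum over
children. Then `L = P + P*` and `P* P = k`, whence `(1 - s P*) (1 - s P) = -s (L - lam)`. Inverting
the two factors gives a Green function whose entries are finite sums, polynomial in `s`
(`IsBranching.hasSum_green`).

An eigenfunction thus solves `φ = K s φ`, where `K s` is the Green function times the modified
potential. After conjugation by a weight, the decay of `M` bounds `K s` on a disc of radius `r > 1`,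
uniformly in its first variable, by a summable function of the second. This disc contains both
points `±1/√k`. A Fredholm reduction to a finite determinant (`exists_analytic_determinant`) yields
an analytic `D` vanishing at every `s` that comes from an eigenvalue, with `D 0 ≠ 0` because `K 0 =
0`. The zeros of `D` are isolated. Since `k (s - s₀) ^ 2 = s (t - z)` at a threshold `t`,
eigenvalues accumulating at `t` would give zeros of `D` accumulating at `s₀`, which is impossible.
-/

namespace RegularTree

/-! ### Analytic Fredholm theory for summable kernels on bounded functions. -/

section Fredholm

variable {ι : Type*}

/-- The iterates of the integral operator with kernel `T`, applied to `g`. -/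
noncomputable def kernelIterate (T : ι → ι → ℂ) (g : ι → ℂ) : ℕ → ι → ℂ
  | 0 => g
  | n + 1 => fun v => ∑' u, T v u * kernelIterate T g n u

theorem summable_kernel_mul {T : ι → ι → ℂ} {b : ι → ℝ} (hb : Summable b)
    (hT : ∀ v u, ‖T v u‖ ≤ b u) {g : ι → ℂ} {C : ℝ} (hg : ∀ v, ‖g v‖ ≤ C) (v : ι) :
    Summable fun u => T v u * g u := by
  refine Summable.of_norm_bounded (hb.mul_right C) fun u => ?_
  rw [norm_mul]
  exact mul_le_mul (hT v u) (hg u) (norm_nonneg _) ((norm_nonneg _).trans (hT v u))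

theorem norm_tsum_kernel_mul_le {T : ι → ι → ℂ} {b : ι → ℝ} (hb : Summable b)
    (hT : ∀ v u, ‖T v u‖ ≤ b u) {g : ι → ℂ} {C : ℝ} (hg : ∀ v, ‖g v‖ ≤ C) (v : ι) :
    ‖∑' u, T v u * g u‖ ≤ (∑' u, b u) * C := by
  refine tsum_of_norm_bounded (hb.hasSum.mul_right C) fun u => ?_
  rw [norm_mul]
  exact mul_le_mul (hT v u) (hg u) (norm_nonneg _) ((norm_nonneg _).trans (hT v u))

theorem norm_kernelIterate_le {T : ι → ι → ℂ} {b : ι → ℝ} (hb : Summable b)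
    (hT : ∀ v u, ‖T v u‖ ≤ b u) {g : ι → ℂ} {C : ℝ} (hg : ∀ v, ‖g v‖ ≤ C) (n : ℕ) :
    ∀ v, ‖kernelIterate T g n v‖ ≤ (∑' u, b u) ^ n * C := by
  induction n with
  | zero => simpa [kernelIterate] using hg
  | succ n ih =>
    intro v
    rw [pow_succ', mul_assoc]
    exact norm_tsum_kernel_mul_le hb hT ih v

theorem differentiableOn_kernelIterate {T : ℂ → ι → ι → ℂ} {g : ℂ → ι → ℂ} {U : Set ℂ}
    (hU : IsOpen U) {b : ι → ℝ} (hb : Summable b) (hT : ∀ z ∈ U, ∀ v u, ‖T z v u‖ ≤ b u)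
    {C : ℝ} (hg : ∀ z ∈ U, ∀ v, ‖g z v‖ ≤ C)
    (hTd : ∀ v u, DifferentiableOn ℂ (fun z => T z v u) U)
    (hgd : ∀ v, DifferentiableOn ℂ (fun z => g z v) U) (n : ℕ) :
    ∀ v, DifferentiableOn ℂ (fun z => kernelIterate (T z) (g z) n v) U := by
  induction n with
  | zero => simpa [kernelIterate] using hgd
  | succ n ih =>
    intro v
    refine Complex.differentiableOn_tsum_of_summable_norm
      (hb.mul_right ((∑' u, b u) ^ n * C)) (fun u => (hTd v u).mul (ih u)) hU fun u z hz => ?_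
    rw [norm_mul]
    exact mul_le_mul (hT z hz v u) (norm_kernelIterate_le hb (hT z hz) (hg z hz) n u)
      (norm_nonneg _) ((norm_nonneg _).trans (hT z hz v u))

/-- The Neumann series of the integral operator with kernel `T`, applied to `g`. -/
noncomputable def neumannSeries (T : ι → ι → ℂ) (g : ι → ℂ) (v : ι) : ℂ :=
  ∑' n, kernelIterate T g n v

theorem summable_geometric_bound {b : ι → ℝ} (h0 : ∀ u, 0 ≤ b u) (h1 : ∑' u, b u < 1) (C : ℝ) :
    Summable fun n : ℕ => (∑' u, b u) ^ n * C :=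
  (summable_geometric_of_lt_one (tsum_nonneg h0) h1).mul_right C

theorem neumannSeries_eq {T : ι → ι → ℂ} {b : ι → ℝ} (hb : Summable b) (h0 : ∀ u, 0 ≤ b u)
    (h1 : ∑' u, b u < 1) (hT : ∀ v u, ‖T v u‖ ≤ b u) {g : ι → ℂ} {C : ℝ}
    (hg : ∀ v, ‖g v‖ ≤ C) (v : ι) :
    neumannSeries T g v = g v + ∑' u, T v u * neumannSeries T g u := by
  have hs : ∀ v, Summable fun n => kernelIterate T g n v := fun v =>
    Summable.of_norm_bounded (summable_geometric_bound h0 h1 C)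
      fun n => norm_kernelIterate_le hb hT hg n v
  have hprod : Summable fun p : ℕ × ι => T v p.2 * kernelIterate T g p.1 p.2 := by
    have hC : ∀ n : ℕ, 0 ≤ (∑' u, b u) ^ n * C := fun n =>
      mul_nonneg (pow_nonneg (tsum_nonneg h0) n) ((norm_nonneg _).trans (hg v))
    refine Summable.of_norm_bounded
      ((summable_geometric_bound h0 h1 C).mul_of_nonneg hb hC h0) fun p => ?_
    rw [norm_mul, mul_comm]
    exact mul_le_mul (norm_kernelIterate_le hb hT hg _ _) (hT _ _) (norm_nonneg _) (hC _)
  calc neumannSeries T g v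
      = g v + ∑' n, kernelIterate T g (n + 1) v := (hs v).tsum_eq_zero_add
    _ = g v + ∑' u, ∑' n, T v u * kernelIterate T g n u := by
        rw [Summable.tsum_comm (f := fun n u => T v u * kernelIterate T g n u) hprod]
        rfl
    _ = g v + ∑' u, T v u * neumannSeries T g u := by
        simp_rw [neumannSeries, tsum_mul_left]

theorem norm_neumannSeries_le {T : ι → ι → ℂ} {b : ι → ℝ} (hb : Summable b) (h0 : ∀ u, 0 ≤ b u)
    (h1 : ∑' u, b u < 1) (hT : ∀ v u, ‖T v u‖ ≤ b u) {g : ι → ℂ} {C : ℝ}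
    (hg : ∀ v, ‖g v‖ ≤ C) (v : ι) :
    ‖neumannSeries T g v‖ ≤ ∑' n : ℕ, (∑' u, b u) ^ n * C :=
  tsum_of_norm_bounded (summable_geometric_bound h0 h1 C).hasSum
    fun n => norm_kernelIterate_le hb hT hg n v

/-- A bounded fixed point equals all its iterates, and these tend to `0` geometrically. -/
theorem eq_zero_of_kernel_contraction {T : ι → ι → ℂ} {b : ι → ℝ} (hb : Summable b)
    (h0 : ∀ u, 0 ≤ b u) (h1 : ∑' u, b u < 1) (hT : ∀ v u, ‖T v u‖ ≤ b u) {g : ι → ℂ} {C : ℝ}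
    (hg : ∀ v, ‖g v‖ ≤ C) (h : ∀ v, g v = ∑' u, T v u * g u) (v : ι) : g v = 0 := by
  have hit : ∀ n, kernelIterate T g n = g := by
    intro n
    induction n with
    | zero => rfl
    | succ n ih =>
      funext v
      simp only [kernelIterate, ih]
      exact (h v).symm
  have hlim : Tendsto (fun n : ℕ => (∑' u, b u) ^ n * C) atTop (𝓝 0) :=
    (summable_geometric_bound h0 h1 C).tendsto_atTop_zero
  have hle : ‖g v‖ ≤ 0 := ge_of_tendsto' hlim fun n => by
    simpa [hit n] using norm_kernelIterate_le hb hT hg n v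
  simpa using hle

theorem exists_finset_tsum_ite_lt_one (b : ι → ℝ) [DecidableEq ι] :
    ∃ F : Finset ι, (∑' u, if u ∈ F then 0 else b u) < 1 := by
  obtain ⟨F, hF⟩ := ((tendsto_order.1 (tendsto_tsum_compl_atTop_zero b)).2 1 one_pos).exists
  refine ⟨F, lt_of_eq_of_lt ?_ hF⟩
  rw [show (∑' a : { x // x ∉ F }, b a) = ∑' x, Set.indicator {x | x ∉ F} b x from
    tsum_subtype {x | x ∉ F} b]
  refine tsum_congr fun u => ?_
  by_cases hu : u ∈ F <;> simp [hu]

/-- A scalar analytic function which vanishes wherever a homogeneous equation `ψ = K z ψ`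
with an analytic family of summable kernels has a nonzero bounded solution. -/
theorem exists_analytic_determinant {K : ℂ → ι → ι → ℂ} {U : Set ℂ} (hU : IsOpen U)
    (hU0 : (0 : ℂ) ∈ U) {b : ι → ℝ} (hb : Summable b) (hK : ∀ z ∈ U, ∀ v w, ‖K z v w‖ ≤ b w)
    (hKd : ∀ v w, DifferentiableOn ℂ (fun z => K z v w) U) (hK0 : ∀ v w, K 0 v w = 0) :
    ∃ D : ℂ → ℂ, DifferentiableOn ℂ D U ∧ D 0 ≠ 0 ∧
      ∀ z ∈ U, ∀ ψ : ι → ℂ, (∃ C, ∀ v, ‖ψ v‖ ≤ C) → (∃ v, ψ v ≠ 0) →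
        (∀ v, ψ v = ∑' w, K z v w * ψ w) → D z = 0 := by
  classical
  have hb0 : ∀ u, 0 ≤ b u := fun u => (norm_nonneg _).trans (hK 0 hU0 u u)
  -- Columns outside `F` have total mass below `1`, uniformly in `z`, so the truncated kernel `T`
  -- can be inverted by a Neumann series. The finitely many columns in `F` carry the determinant.
  obtain ⟨F, hF⟩ := exists_finset_tsum_ite_lt_one b
  set b' : ι → ℝ := fun u => if u ∈ F then 0 else b u with hb'
  have hb'0 : ∀ u, 0 ≤ b' u := fun u => by simp only [hb']; split_ifs; exacts [le_rfl, hb0 u]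
  have hb's : Summable b' := Summable.of_nonneg_of_le hb'0
    (fun u => by simp only [hb']; split_ifs; exacts [hb0 u, le_rfl]) hb
  let T : ℂ → ι → ι → ℂ := fun z v u => if u ∈ F then 0 else K z v u
  have hT : ∀ z ∈ U, ∀ v u, ‖T z v u‖ ≤ b' u := fun z hz v u => by
    simp only [T, hb']
    split_ifs
    exacts [by simp, hK z hz v u]
  have hTd : ∀ v u, DifferentiableOn ℂ (fun z => T z v u) U := fun v u => by
    simp only [T]
    split_ifs
    exacts [differentiableOn_const _, hKd v u]
  -- Column `w` of `(1 - T)⁻¹ K`. A solution satisfies `ψ = ∑ w ∈ F, B · w * ψ w`, so it is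
  -- determined by its restriction to `F`, which lies in the kernel of `1 - B` on `F`.
  let B : ℂ → ι → ι → ℂ := fun z v w => neumannSeries (T z) (fun u => K z u w) v
  have hKw : ∀ z ∈ U, ∀ w v, ‖(fun u => K z u w) v‖ ≤ b w := fun z hz w v => hK z hz v w
  have hBd : ∀ v w, DifferentiableOn ℂ (fun z => B z v w) U := fun v w =>
    Complex.differentiableOn_tsum_of_summable_norm (summable_geometric_bound hb'0 hF (b w))
      (fun n => differentiableOn_kernelIterate (g := fun z u => K z u w) hU hb's hT
        (fun z hz => hKw z hz w) hTd (fun u => hKd u w) n v) hU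
      fun n z hz => norm_kernelIterate_le hb's (hT z hz) (hKw z hz w) n v
  have hB0 : ∀ v w, B 0 v w = 0 := fun v w => by
    have h := norm_neumannSeries_le hb's hb'0 hF (hT 0 hU0) (g := fun u => K 0 u w) (C := 0)
      (fun u => by simp [hK0]) v
    simpa [B] using h
  let A : ℂ → Matrix F F ℂ := fun z => 1 - Matrix.of fun v w : F => B z v w
  have hA : ∀ v w : F, DifferentiableOn ℂ (fun z => A z v w) U := fun v w => by
    simp only [A, Matrix.sub_apply, Matrix.of_apply]
    exact (differentiableOn_const _).sub (hBd v w)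
  refine ⟨fun z => (A z).det, ?_, ?_, ?_⟩
  · simp only [Matrix.det_apply]
    exact DifferentiableOn.fun_sum fun σ _ => DifferentiableOn.const_smul
      (DifferentiableOn.fun_finsetProd fun i _ => hA _ _) _
  · have : A 0 = 1 := by
      ext v w
      simp [A, hB0]
    simp [this]
  · rintro z hz ψ ⟨C, hC⟩ hne hψ
    by_contra hdet
    have hsplit : ∀ v, ψ v = ∑ w ∈ F, K z v w * ψ w + ∑' w, T z v w * ψ w := by
      intro v
      have h1 := summable_kernel_mul hb (hK z hz) hC v
      have h2 := summable_kernel_mul hb's (hT z hz) hC v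
      have h3 : HasSum (fun w => if w ∈ F then K z v w * ψ w else 0)
          (∑ w ∈ F, K z v w * ψ w) := by
        have h : HasSum (fun w => if w ∈ F then K z v w * ψ w else 0)
            (∑ w ∈ F, if w ∈ F then K z v w * ψ w else 0) :=
          hasSum_sum_of_ne_finset_zero fun w hw => if_neg hw
        rwa [Finset.sum_congr rfl (fun w hw => if_pos hw)] at h
      rw [hψ v, ← (h3.add h2.hasSum).tsum_eq]
      refine tsum_congr fun w => ?_
      by_cases hw : w ∈ F <;> simp [T, hw]
    -- The difference is a bounded fixed point of the contraction `T`.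
    have hrep : ∀ v, ψ v - ∑ w ∈ F, B z v w * ψ w = 0 := by
      set S : ℝ := ∑ w ∈ F, (∑' n : ℕ, (∑' u, b' u) ^ n * b w) * C
      have hBb : ∀ w v, ‖B z v w‖ ≤ ∑' n : ℕ, (∑' u, b' u) ^ n * b w := fun w v =>
        norm_neumannSeries_le hb's hb'0 hF (hT z hz) (hKw z hz w) v
      refine eq_zero_of_kernel_contraction (C := C + S) hb's hb'0 hF (hT z hz) (fun v => ?_)
        fun v => ?_
      · refine (norm_sub_le _ _).trans (add_le_add (hC v) (norm_sum_le_of_le _ fun w _ => ?_))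
        rw [norm_mul]
        exact mul_le_mul (hBb w v) (hC w) (norm_nonneg _) ((norm_nonneg _).trans (hBb w v))
      · have hsB : ∀ w, Summable fun u => T z v u * B z u w := fun w =>
          summable_kernel_mul hb's (hT z hz) (hBb w) v
        have hsum : HasSum (fun u => T z v u * (ψ u - ∑ w ∈ F, B z u w * ψ w))
            (∑' u, T z v u * ψ u - ∑ w ∈ F, (∑' u, T z v u * B z u w) * ψ w) := by
          have := (summable_kernel_mul hb's (hT z hz) hC v).hasSum.sub
            (hasSum_sum (s := F) fun w _ => (hsB w).hasSum.mul_right (ψ w))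
          refine (congrArg (HasSum · _) (funext fun u => ?_)).mpr this
          rw [mul_sub, Finset.mul_sum]
          simp only [mul_assoc]
        have hBv : ∑ w ∈ F, B z v w * ψ w =
            ∑ w ∈ F, K z v w * ψ w + ∑ w ∈ F, (∑' u, T z v u * B z u w) * ψ w := by
          rw [← Finset.sum_add_distrib]
          refine Finset.sum_congr rfl fun w _ => ?_
          rw [← add_mul]
          exact congrArg (· * ψ w) (neumannSeries_eq hb's hb'0 hF (hT z hz) (hKw z hz w) v)
        rw [hsum.tsum_eq, hsplit v, hBv]
        ring
    have hF0 : (fun w : F => ψ w) = 0 := by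
      refine Matrix.eq_zero_of_mulVec_eq_zero hdet ?_
      ext v
      have h := hrep v
      rw [← Finset.sum_coe_sort] at h
      simp only [A, Matrix.sub_mulVec, Matrix.one_mulVec, Pi.sub_apply, Pi.zero_apply]
      exact h
    obtain ⟨v, hv⟩ := hne
    refine hv ?_
    have h := hrep v
    rw [Finset.sum_eq_zero fun w hw => by
      rw [show ψ w = 0 from congrFun hF0 ⟨w, hw⟩, mul_zero], sub_zero] at h
    exact h

end Fredholm

/-! ### The tree in terms of levels, parents and children. -/

section Branching

/-- A combinatorial description of the `k`-fold branching tree: `lev` is the distance to the root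
`o`, `par` sends a vertex to its parent and `ch v` is the set of the `k` children of `v`. -/
structure IsBranching {V : Type u} (o : V) (k : ℕ) (lev : V → ℕ) (par : V → V)
    (ch : V → Finset V) : Prop where
  lev_eq_zero : ∀ v, lev v = 0 ↔ v = o
  mem_ch : ∀ v c, c ∈ ch v ↔ par c = v ∧ c ≠ o
  lev_par : ∀ c, c ≠ o → lev c = lev (par c) + 1
  card_ch : ∀ v, (ch v).card = k

variable {V : Type u} {o : V} {k : ℕ}

theorem _root_.SimpleGraph.IsTree.exists_adj_dist {G : SimpleGraph V} (hG : G.IsTree) {v : V}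
    (hv : v ≠ o) : ∃ u, G.Adj u v ∧ G.dist o v = G.dist o u + 1 := by
  obtain ⟨w, hw, hwl⟩ := hG.connected.exists_path_of_dist o v
  have hnil : ¬ w.Nil := SimpleGraph.Walk.not_nil_of_ne hv.symm
  have hadj := w.adj_penultimate hnil
  refine ⟨w.penultimate, hadj, ?_⟩
  rcases hG.dist_eq_dist_add_one_of_adj o hadj with h | h
  · have h1 := SimpleGraph.dist_le w.dropLast
    have h2 : w.dropLast.length = w.length - 1 := by simp
    omega
  · exact h

/-- Parents are unique: a geodesic to `u` or to `u'`, extended to `v`, is the unique path from `o`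
to `v`, so its penultimate vertex is the same. -/
theorem _root_.SimpleGraph.IsTree.eq_of_adj_dist {G : SimpleGraph V} (hG : G.IsTree)
    {u u' v : V} (hu : G.Adj u v) (hu' : G.Adj u' v) (hd : G.dist o v = G.dist o u + 1)
    (hd' : G.dist o v = G.dist o u' + 1) : u = u' := by
  have key : ∀ x, G.Adj x v → G.dist o v = G.dist o x + 1 →
      ∃ w : G.Walk o v, w.IsPath ∧ w.penultimate = x := by
    intro x hx hdx
    obtain ⟨w, -, hwl⟩ := hG.connected.exists_path_of_dist o x
    refine ⟨w.concat hx, SimpleGraph.Walk.isPath_of_length_eq_dist _ ?_, by simp⟩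
    rw [SimpleGraph.Walk.length_concat, hwl, hdx]
  obtain ⟨w, hw, rfl⟩ := key u hu hd
  obtain ⟨w', hw', rfl⟩ := key u' hu' hd'
  rw [(hG.existsUnique_path o v).unique hw hw']

theorem IsRegularRootedTree.exists_branching {G : SimpleGraph V} [G.LocallyFinite]
    (hG : IsRegularRootedTree G o k) : ∃ (par : V → V) (ch : V → Finset V),
      IsBranching o k (G.dist o) par ch ∧ ∀ (φ : V → ℂ) v,
        (∑ w ∈ G.neighborFinset o, φ w = ∑ c ∈ ch o, φ c) ∧
        (v ≠ o → ∑ w ∈ G.neighborFinset v, φ w = φ (par v) + ∑ c ∈ ch v, φ c) := by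
  classical
  have hT := hG.isTree
  have hex : ∀ v, ∃ u, v ≠ o → G.Adj u v ∧ G.dist o v = G.dist o u + 1 := by
    intro v
    by_cases hv : v = o
    · exact ⟨o, fun h => absurd hv h⟩
    · obtain ⟨u, hu⟩ := hT.exists_adj_dist hv
      exact ⟨u, fun _ => hu⟩
  choose par hpar using hex
  let ch : V → Finset V := fun v => (G.neighborFinset v).filter fun c => G.dist o c = G.dist o v + 1
  have hne : ∀ c n, G.dist o c = n + 1 → c ≠ o := by
    rintro c n h rfl
    simp at h
  have hmem : ∀ v c, c ∈ ch v ↔ par c = v ∧ c ≠ o := by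
    intro v c
    simp only [ch, Finset.mem_filter, SimpleGraph.mem_neighborFinset]
    constructor
    · rintro ⟨hadj, hd⟩
      have hc := hne c _ hd
      exact ⟨hT.eq_of_adj_dist (hpar c hc).1 hadj (hpar c hc).2 hd, hc⟩
    · rintro ⟨rfl, hc⟩
      exact hpar c hc
  have hroot : ch o = G.neighborFinset o := by
    refine Finset.filter_true_of_mem fun c hc => ?_
    rw [SimpleGraph.mem_neighborFinset] at hc
    rcases hT.dist_eq_dist_add_one_of_adj o hc with h | h
    · simp at h
    · exact h
  have hpn : ∀ v, v ≠ o → par v ∉ ch v := by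
    intro v hv h
    have h1 := (Finset.mem_filter.1 h).2
    have h2 := (hpar v hv).2
    omega
  have hnb : ∀ v, v ≠ o → G.neighborFinset v = insert (par v) (ch v) := by
    intro v hv
    ext c
    simp only [Finset.mem_insert, ch, Finset.mem_filter, SimpleGraph.mem_neighborFinset]
    constructor
    · intro hadj
      rcases hT.dist_eq_dist_add_one_of_adj o hadj with h | h
      · exact Or.inl (hT.eq_of_adj_dist hadj.symm (hpar v hv).1 h (hpar v hv).2)
      · exact Or.inr ⟨hadj, h⟩
    · rintro (rfl | h)
      · exact (hpar v hv).1.symm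
      · exact h.1
  refine ⟨par, ch, ⟨fun v => ?_, hmem, fun c hc => (hpar c hc).2, fun v => ?_⟩,
    fun φ v => ⟨by rw [hroot], fun hv => ?_⟩⟩
  · rw [hT.connected.dist_eq_zero_iff, eq_comm]
  · by_cases hv : v = o
    · rw [hv, hroot, SimpleGraph.card_neighborFinset_eq_degree, hG.degree_root]
    · have h := hG.degree_of_ne v hv
      rw [← SimpleGraph.card_neighborFinset_eq_degree, hnb v hv,
        Finset.card_insert_of_notMem (hpn v hv)] at h
      omega
  · rw [hnb v hv, Finset.sum_insert (hpn v hv)]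

open Classical in
/-- The set of vertices at distance `n` from the root. -/
noncomputable def sphere (o : V) (ch : V → Finset V) : ℕ → Finset V
  | 0 => {o}
  | n + 1 => (sphere o ch n).biUnion ch

variable {lev : V → ℕ} {par : V → V} {ch : V → Finset V}

theorem IsBranching.mem_sphere (h : IsBranching o k lev par ch) (n : ℕ) :
    ∀ v, v ∈ sphere o ch n ↔ lev v = n := by
  induction n with
  | zero => intro v; simp [sphere, h.lev_eq_zero]
  | succ n ih =>
    intro v
    simp only [sphere, Finset.mem_biUnion, ih, h.mem_ch]
    constructor
    · rintro ⟨w, hw, rfl, hv⟩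
      rw [h.lev_par v hv, hw]
    · intro hv
      have hvo : v ≠ o := fun hvo => by rw [(h.lev_eq_zero v).2 hvo] at hv; omega
      have := h.lev_par v hvo
      exact ⟨par v, by omega, rfl, hvo⟩

theorem IsBranching.sum_sphere_succ (h : IsBranching o k lev par ch) {β : Type*}
    [AddCommMonoid β] (f : V → β) (n : ℕ) :
    ∑ v ∈ sphere o ch (n + 1), f v = ∑ v ∈ sphere o ch n, ∑ c ∈ ch v, f c := by
  classical
  rw [sphere]
  convert Finset.sum_biUnion ?_
  intro v _ w _ hvw
  refine Finset.disjoint_left.2 fun c hc hc' => hvw ?_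
  rw [← ((h.mem_ch v c).1 hc).1, ← ((h.mem_ch w c).1 hc').1]

theorem IsBranching.card_sphere (h : IsBranching o k lev par ch) (n : ℕ) :
    (sphere o ch n).card = k ^ n := by
  induction n with
  | zero => simp [sphere]
  | succ n ih =>
    rw [Finset.card_eq_sum_ones, h.sum_sphere_succ]
    simp [h.card_ch, ih, pow_succ]

theorem IsBranching.pairwiseDisjoint_sphere (h : IsBranching o k lev par ch) (s : Set ℕ) :
    s.PairwiseDisjoint (sphere o ch) := by
  intro m _ n _ hmn
  refine Finset.disjoint_left.2 fun v hm hn => hmn ?_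
  rw [← (h.mem_sphere m v).1 hm, ← (h.mem_sphere n v).1 hn]

theorem IsBranching.exists_subset_ball (h : IsBranching o k lev par ch) [DecidableEq V]
    (s : Finset V) : ∃ N, s ⊆ (Finset.range N).biUnion (sphere o ch) := by
  refine ⟨s.sup lev + 1, fun v hv => ?_⟩
  simp only [Finset.mem_biUnion, Finset.mem_range, h.mem_sphere]
  exact ⟨lev v, Nat.lt_succ_of_le (Finset.le_sup hv), rfl⟩

/-- The sphere of radius `n` has `k ^ n` points; this is where the growth of the tree competes with
the decay of the potential. -/
theorem IsBranching.summable_lev (h : IsBranching o k lev par ch) {F : ℕ → ℝ}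
    (hF0 : ∀ n, 0 ≤ F n) (hF : Summable fun n => (k : ℝ) ^ n * F n) :
    Summable fun v => F (lev v) := by
  classical
  refine summable_of_sum_le (c := ∑' n, (k : ℝ) ^ n * F n) (fun v => hF0 _) fun s => ?_
  obtain ⟨N, hN⟩ := h.exists_subset_ball s
  calc ∑ v ∈ s, F (lev v) ≤ ∑ v ∈ (Finset.range N).biUnion (sphere o ch), F (lev v) :=
        Finset.sum_le_sum_of_subset_of_nonneg hN fun _ _ _ => hF0 _
    _ = ∑ n ∈ Finset.range N, ∑ v ∈ sphere o ch n, F (lev v) :=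
        Finset.sum_biUnion (h.pairwiseDisjoint_sphere _)
    _ = ∑ n ∈ Finset.range N, (k : ℝ) ^ n * F n := by
        refine Finset.sum_congr rfl fun n _ => ?_
        rw [Finset.sum_congr rfl fun v hv => by rw [(h.mem_sphere n v).1 hv], Finset.sum_const,
          h.card_sphere, nsmul_eq_mul, Nat.cast_pow]
    _ ≤ _ := hF.sum_le_tsum _ fun n _ => mul_nonneg (by positivity) (hF0 n)

theorem IsBranching.hasSum_sphere (h : IsBranching o k lev par ch) {β : Type*}
    [AddCommMonoid β] [TopologicalSpace β] {f : V → β} {a : β} (hf : HasSum f a) :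
    Tendsto (fun N => ∑ n ∈ Finset.range N, ∑ v ∈ sphere o ch n, f v) atTop (𝓝 a) := by
  classical
  have hmono : Tendsto (fun N => (Finset.range N).biUnion (sphere o ch)) atTop atTop := by
    refine tendsto_atTop_finset_of_monotone (fun m n hmn => ?_) fun v => ?_
    · exact Finset.biUnion_subset_biUnion_of_subset_left _ (Finset.range_mono hmn)
    · obtain ⟨N, hN⟩ := h.exists_subset_ball {v}
      exact ⟨N, hN (Finset.mem_singleton_self v)⟩
  refine (hf.comp hmono).congr fun N => ?_
  exact Finset.sum_biUnion (h.pairwiseDisjoint_sphere _)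

end Branching

/-! ### The Green function from the factorization of `L - λ`. -/

section Green

variable {V : Type u} {o : V} {k : ℕ} {lev : V → ℕ} {par : V → V} {ch : V → Finset V}

/-- The value `par o` is unconstrained, so iterates of `par` are used only up to the root; hence the
ranges `lev + 1` in `pathSum` and `green`. -/
theorem IsBranching.lev_iterate (h : IsBranching o k lev par ch) (w : V) (j : ℕ)
    (hj : j ≤ lev w) : lev (par^[j] w) + j = lev w := by
  induction j with
  | zero => simp
  | succ j ih =>
    have h1 := ih (by omega)
    have hne : par^[j] w ≠ o := fun h0 => by
      rw [(h.lev_eq_zero _).2 h0] at h1; omega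
    have h2 := h.lev_par _ hne
    rw [Function.iterate_succ_apply']
    omega

open Classical in
/-- The kernel of `(1 - s P)⁻¹`, where `P φ = φ ∘ par`: it is `s ^ d(a, w)` if `a` is an ancestor
of `w` and `0` otherwise. -/
noncomputable def pathSum (lev : V → ℕ) (par : V → V) (s : ℂ) (a w : V) : ℂ :=
  ∑ j ∈ Finset.range (lev w + 1), if par^[j] w = a then s ^ j else 0

open Classical in
theorem IsBranching.pathSum_root (h : IsBranching o k lev par ch) (s : ℂ) (a : V) :
    pathSum lev par s a o = if o = a then 1 else 0 := by
  simp [pathSum, (h.lev_eq_zero o).2 rfl]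

open Classical in
theorem IsBranching.pathSum_of_ne (h : IsBranching o k lev par ch) (s : ℂ) (a : V) {c : V}
    (hc : c ≠ o) :
    pathSum lev par s a c = (if c = a then 1 else 0) + s * pathSum lev par s a (par c) := by
  rw [pathSum, h.lev_par c hc, Finset.sum_range_succ', pathSum, Finset.mul_sum, add_comm]
  congr 1
  refine Finset.sum_congr rfl fun j _ => ?_
  rw [Function.iterate_succ_apply, mul_ite, mul_zero, pow_succ']

/-- Levels drop by one along the ancestor line of `w`, so at most one term of the sum survives. -/
theorem IsBranching.pathSum_eq_zero_or (h : IsBranching o k lev par ch) (s : ℂ) (a w : V) :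
    pathSum lev par s a w = 0 ∨
      lev a ≤ lev w ∧ pathSum lev par s a w = s ^ (lev w - lev a) := by
  classical
  rw [or_iff_not_imp_left]
  intro hne
  obtain ⟨j, hj, hjne⟩ := Finset.exists_ne_zero_of_sum_ne_zero hne
  have hlev : ∀ i ∈ Finset.range (lev w + 1), par^[i] w = a → lev a + i = lev w := by
    rintro i hi rfl
    exact h.lev_iterate w i (Nat.lt_succ_iff.1 (Finset.mem_range.1 hi))
  have hja : par^[j] w = a := by
    by_contra hja
    exact hjne (if_neg hja)
  have hjl := hlev j hj hja
  refine ⟨by omega, ?_⟩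
  rw [pathSum, Finset.sum_eq_single_of_mem j hj fun i hi hij => ?_, if_pos hja]
  · congr 1
    omega
  · refine if_neg fun hia => hij ?_
    have := hlev i hi hia
    omega

theorem IsBranching.norm_pathSum_le (h : IsBranching o k lev par ch) {s : ℂ} {r : ℝ}
    (hr : 1 ≤ r) (hs : ‖s‖ ≤ r) (a w : V) : ‖pathSum lev par s a w‖ ≤ r ^ lev w := by
  rcases h.pathSum_eq_zero_or s a w with h0 | ⟨-, h1⟩
  · rw [h0, norm_zero]
    positivity
  · rw [h1, norm_pow]
    exact (pow_le_pow_left₀ (norm_nonneg _) hs _).trans (pow_le_pow_right₀ hr (Nat.sub_le _ _))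

theorem IsBranching.norm_sq_pathSum_mul_le (h : IsBranching o k lev par ch) {s : ℂ}
    (hs : ‖s‖ ^ 2 * k ≤ 1) (a w : V) :
    (k : ℝ) ^ lev w * ‖pathSum lev par s a w‖ ^ 2 ≤ (k : ℝ) ^ lev a := by
  rcases h.pathSum_eq_zero_or s a w with h0 | ⟨hl, h1⟩
  · rw [h0, norm_zero]
    simp
  · obtain ⟨d, hd⟩ := Nat.exists_eq_add_of_le hl
    rw [h1, hd, Nat.add_sub_cancel_left, norm_pow]
    calc (k : ℝ) ^ (lev a + d) * (‖s‖ ^ d) ^ 2 = (k : ℝ) ^ lev a * (‖s‖ ^ 2 * k) ^ d := by ring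
      _ ≤ (k : ℝ) ^ lev a * 1 := by
        gcongr
        exact pow_le_one₀ (by positivity) hs
      _ = _ := mul_one _

theorem differentiable_pathSum (a w : V) :
    Differentiable ℂ fun s => pathSum lev par s a w := by
  classical
  unfold pathSum
  refine Differentiable.fun_sum fun j _ => ?_
  split_ifs <;> fun_prop

/-- The Green function of `L - λ`, where `λ s = k s ^ 2 + 1`. -/
noncomputable def green (lev : V → ℕ) (par : V → V) (s : ℂ) (v w : V) : ℂ :=
  -s * ∑ i ∈ Finset.range (lev v + 1), s ^ i * pathSum lev par s (par^[i] v) w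

/-- Each entry is a polynomial in `s`, so nothing singular happens at `±1/√k`. -/
theorem differentiable_green (v w : V) : Differentiable ℂ fun s => green lev par s v w := by
  unfold green
  refine Differentiable.mul (by fun_prop) (Differentiable.fun_sum fun i _ => ?_)
  exact Differentiable.mul (by fun_prop) (differentiable_pathSum _ _)

/-- Crude, but valid beyond the disc `‖s‖ ^ 2 * k ≤ 1`; the growth in `v` and `w` is absorbed later
by a weight and by the potential. -/
theorem IsBranching.norm_green_le (h : IsBranching o k lev par ch) {s : ℂ} {r : ℝ}
    (hr : 1 ≤ r) (hs : ‖s‖ ≤ r) (v w : V) :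
    ‖green lev par s v w‖ ≤ r * (((lev v : ℝ) + 1) * r ^ lev v * r ^ lev w) := by
  rw [green, norm_mul, norm_neg]
  refine mul_le_mul hs ?_ (norm_nonneg _) (by positivity)
  have hle : ∀ i ∈ Finset.range (lev v + 1),
      ‖s ^ i * pathSum lev par s (par^[i] v) w‖ ≤ r ^ lev v * r ^ lev w := by
    intro i hi
    rw [norm_mul, norm_pow]
    refine mul_le_mul ?_ (h.norm_pathSum_le hr hs _ _) (norm_nonneg _) (by positivity)
    exact (pow_le_pow_left₀ (norm_nonneg _) hs _).trans
      (pow_le_pow_right₀ hr (Nat.lt_succ_iff.1 (Finset.mem_range.1 hi)))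
  refine (norm_sum_le_of_le _ hle).trans (le_of_eq ?_)
  rw [Finset.sum_const, Finset.card_range, nsmul_eq_mul]
  push_cast
  ring

open Classical in
/-- The function `φ - s P φ`, where `(P φ) v = φ (par v)` off the root and `(P φ) o = 0`. -/
noncomputable def subParent (o : V) (par : V → V) (s : ℂ) (φ : V → ℂ) (v : V) : ℂ :=
  φ v - if v = o then 0 else s * φ (par v)

/-- Inverts `1 - s P` by its geometric series, which terminates at the root. -/
theorem IsBranching.sum_subParent_iterate (h : IsBranching o k lev par ch) (s : ℂ) (φ : V → ℂ)
    (n : ℕ) : ∀ v, lev v = n →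
      ∑ i ∈ Finset.range (n + 1), s ^ i * subParent o par s φ (par^[i] v) = φ v := by
  induction n with
  | zero =>
    intro v hv
    simp [subParent, (h.lev_eq_zero v).1 hv]
  | succ n ih =>
    intro v hv
    have hvo : v ≠ o := fun h0 => by rw [(h.lev_eq_zero v).2 h0] at hv; omega
    have hp := h.lev_par v hvo
    rw [Finset.sum_range_succ', Finset.sum_congr rfl fun i _ => by
      rw [Function.iterate_succ_apply, pow_succ', mul_assoc], ← Finset.mul_sum,
      ih (par v) (by omega)]
    simp [subParent, hvo]

open Classical in
/-- The equation `(L - λ) φ = f`, with the sum over the neighbours split into parent and children. -/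
def SolvesAt (o : V) (par : V → V) (ch : V → Finset V) (lam : ℂ) (φ f : V → ℂ) (v : V) : Prop :=
  (∑ c ∈ ch v, φ c + if v = o then 0 else φ (par v)) - lam * φ v = f v

/-- The factorization `(1 - s P*) (1 - s P) = -s (L - λ)`, with `χ = (1 - s P) φ`: it says `(1 - s
P*) χ = -s f`. The relation `P* P = k` holds at the root too, because the root also has `k`
children. -/
theorem IsBranching.mul_sum_subParent (h : IsBranching o k lev par ch) {s lam : ℂ}
    (hs : lam * s = k * s ^ 2 + 1) {φ f : V → ℂ} {v : V}
    (hv : SolvesAt o par ch lam φ f v) :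
    s * ∑ c ∈ ch v, subParent o par s φ c = subParent o par s φ v + s * f v := by
  have h1 : ∑ c ∈ ch v, subParent o par s φ c = ∑ c ∈ ch v, φ c - k * (s * φ v) := by
    rw [← h.card_ch v, ← nsmul_eq_mul, ← Finset.sum_const, ← Finset.sum_sub_distrib]
    refine Finset.sum_congr rfl fun c hc => ?_
    obtain ⟨hp, hco⟩ := (h.mem_ch v c).1 hc
    rw [subParent, if_neg hco, hp]
  rw [h1, ← hv, subParent]
  split_ifs
  · linear_combination φ v * hs
  · linear_combination φ v * hs

/-- Solves `(1 - s P*) χ = -s f` by iteration along the descendants of `a`: passing from one sphere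
to the next trades `s` times the sum of `χ` over children for `χ + s f`. The left side is the
remainder after level `n`. -/
theorem IsBranching.sum_sphere_pathSum (h : IsBranching o k lev par ch) {s lam : ℂ}
    (hs : lam * s = k * s ^ 2 + 1) {φ f : V → ℂ} (hφ : ∀ v, SolvesAt o par ch lam φ f v)
    (a : V) (n : ℕ) :
    ∑ w ∈ sphere o ch n, pathSum lev par s a w * subParent o par s φ w =
      (if lev a ≤ n then subParent o par s φ a else 0) +
        s * ∑ m ∈ Finset.range n, ∑ w ∈ sphere o ch m, pathSum lev par s a w * f w := by
  classical
  set χ := subParent o par s φ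
  induction n with
  | zero =>
    simp only [sphere, Finset.sum_singleton, h.pathSum_root, Nat.le_zero, h.lev_eq_zero,
      Finset.range_zero, Finset.sum_empty, mul_zero, add_zero]
    by_cases ha : o = a
    · subst ha; simp
    · simp [ha, Ne.symm ha]
  | succ n ih =>
    have h1 : ∀ c ∈ sphere o ch (n + 1), pathSum lev par s a c * χ c =
        (if c = a then χ c else 0) + s * pathSum lev par s a (par c) * χ c := by
      intro c hc
      have hco : c ≠ o := fun h0 => by
        have := (h.mem_sphere _ _).1 hc
        rw [(h.lev_eq_zero c).2 h0] at this
        omega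
      rw [h.pathSum_of_ne s a hco, add_mul, ite_mul, one_mul, zero_mul]
    have h2 : ∑ c ∈ sphere o ch (n + 1), s * pathSum lev par s a (par c) * χ c =
        ∑ w ∈ sphere o ch n, pathSum lev par s a w * χ w +
          s * ∑ w ∈ sphere o ch n, pathSum lev par s a w * f w := by
      rw [h.sum_sphere_succ, Finset.mul_sum, ← Finset.sum_add_distrib]
      refine Finset.sum_congr rfl fun w _ => ?_
      have h3 := h.mul_sum_subParent hs (hφ w)
      calc ∑ c ∈ ch w, s * pathSum lev par s a (par c) * χ c
          = pathSum lev par s a w * (s * ∑ c ∈ ch w, χ c) := by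
            rw [Finset.mul_sum, Finset.mul_sum]
            refine Finset.sum_congr rfl fun c hc => ?_
            rw [((h.mem_ch w c).1 hc).1]
            ring
        _ = _ := by rw [h3]; ring
    rw [Finset.sum_congr rfl h1, Finset.sum_add_distrib, h2, ih, Finset.sum_ite_eq',
      Finset.sum_range_succ]
    simp only [h.mem_sphere]
    rcases lt_trichotomy (lev a) (n + 1) with hlt | heq | hgt
    · rw [if_neg hlt.ne, if_pos (Nat.lt_succ_iff.1 hlt), if_pos hlt.le]
      ring
    · rw [if_pos heq, if_neg (by omega), if_pos heq.le]
      ring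
    · rw [if_neg hgt.ne', if_neg (by omega), if_neg (by omega)]
      ring

theorem IsBranching.tendsto_sum_sphere (h : IsBranching o k lev par ch) {g : V → ℝ}
    (hg : Summable g) : Tendsto (fun n => ∑ v ∈ sphere o ch n, g v) atTop (𝓝 0) := by
  have h1 := h.hasSum_sphere hg.hasSum
  have h2 := (h1.comp (tendsto_add_atTop_nat 1)).sub h1
  rw [sub_self] at h2
  refine h2.congr fun n => ?_
  simp [Finset.sum_range_succ]

theorem IsBranching.tendsto_sum_sphere_subParent (h : IsBranching o k lev par ch) {s : ℂ}
    (hs : ‖s‖ ^ 2 * k ≤ 1) {φ : V → ℂ} (hφ : Summable fun v => ‖φ v‖ ^ 2) :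
    Tendsto (fun n => ∑ v ∈ sphere o ch n, ‖subParent o par s φ v‖ ^ 2) atTop (𝓝 0) := by
  have hN := h.tendsto_sum_sphere hφ
  rw [← tendsto_add_atTop_iff_nat 1]
  have hlim := ((hN.comp (tendsto_add_atTop_nat 1)).add hN).const_mul 2
  rw [add_zero, mul_zero] at hlim
  refine squeeze_zero (fun n => Finset.sum_nonneg fun v _ => by positivity) (fun n => ?_) hlim
  have hpt : ∀ v ∈ sphere o ch (n + 1), ‖subParent o par s φ v‖ ^ 2 ≤
      2 * ‖φ v‖ ^ 2 + 2 * (‖s‖ ^ 2 * ‖φ (par v)‖ ^ 2) := by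
    intro v hv
    have hvo : v ≠ o := fun h0 => by
      have := (h.mem_sphere _ _).1 hv
      rw [(h.lev_eq_zero v).2 h0] at this
      omega
    rw [subParent, if_neg hvo]
    have h1 : ‖φ v - s * φ (par v)‖ ≤ ‖φ v‖ + ‖s‖ * ‖φ (par v)‖ := by
      rw [← norm_mul]
      exact norm_sub_le _ _
    calc ‖φ v - s * φ (par v)‖ ^ 2 ≤ (‖φ v‖ + ‖s‖ * ‖φ (par v)‖) ^ 2 := by gcongr
      _ ≤ _ := by nlinarith [sq_nonneg (‖φ v‖ - ‖s‖ * ‖φ (par v)‖)]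
  refine (Finset.sum_le_sum hpt).trans ?_
  rw [Finset.sum_add_distrib, ← Finset.mul_sum, ← Finset.mul_sum, ← Finset.mul_sum, ← mul_add]
  have h3 : ∑ v ∈ sphere o ch (n + 1), ‖φ (par v)‖ ^ 2 =
      k * ∑ v ∈ sphere o ch n, ‖φ v‖ ^ 2 := by
    rw [h.sum_sphere_succ, Finset.mul_sum]
    refine Finset.sum_congr rfl fun v _ => ?_
    rw [Finset.sum_congr rfl fun c hc => by rw [((h.mem_ch v c).1 hc).1], Finset.sum_const,
      h.card_ch, nsmul_eq_mul]
  have h4 : 0 ≤ ∑ v ∈ sphere o ch n, ‖φ v‖ ^ 2 := Finset.sum_nonneg fun v _ => by positivity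
  rw [h3, ← mul_assoc]
  simp only [Function.comp]
  have := mul_le_mul_of_nonneg_right hs h4
  linarith

/-- Cauchy–Schwarz: on each sphere the squares of `pathSum` sum to at most `k ^ lev a`, while those
of `χ` tend to `0`. The case `‖s‖ ^ 2 * k = 1` is included, so eigenvalues with `s` on the boundary
circle are covered. -/
theorem IsBranching.tendsto_sum_sphere_pathSum (h : IsBranching o k lev par ch) {s : ℂ}
    (hs : ‖s‖ ^ 2 * k ≤ 1) {φ : V → ℂ} (hφ : Summable fun v => ‖φ v‖ ^ 2) (a : V) :
    Tendsto (fun n => ∑ w ∈ sphere o ch n, pathSum lev par s a w * subParent o par s φ w)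
      atTop (𝓝 0) := by
  set χ := subParent o par s φ
  have h1 := ((h.tendsto_sum_sphere_subParent hs hφ).const_mul ((k : ℝ) ^ lev a)).sqrt
  rw [mul_zero, Real.sqrt_zero] at h1
  refine squeeze_zero_norm (fun n => ?_) h1
  refine Real.le_sqrt_of_sq_le ?_
  have hS : ∑ w ∈ sphere o ch n, ‖pathSum lev par s a w‖ ^ 2 ≤ (k : ℝ) ^ lev a := by
    rcases Nat.eq_zero_or_pos ((sphere o ch n).card) with h0 | hpos
    · rw [Finset.card_eq_zero.1 h0, Finset.sum_empty]
      positivity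
    · have hk : (0 : ℝ) < (k : ℝ) ^ n := by
        rw [h.card_sphere] at hpos
        exact_mod_cast hpos
      refine le_of_mul_le_mul_left ?_ hk
      rw [Finset.mul_sum]
      calc ∑ w ∈ sphere o ch n, (k : ℝ) ^ n * ‖pathSum lev par s a w‖ ^ 2
          ≤ ∑ w ∈ sphere o ch n, (k : ℝ) ^ lev a := by
            refine Finset.sum_le_sum fun w hw => ?_
            rw [← (h.mem_sphere n w).1 hw]
            exact h.norm_sq_pathSum_mul_le hs a w
        _ = (k : ℝ) ^ n * (k : ℝ) ^ lev a := by
            rw [Finset.sum_const, h.card_sphere, nsmul_eq_mul, Nat.cast_pow]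
  calc ‖∑ w ∈ sphere o ch n, pathSum lev par s a w * χ w‖ ^ 2
      ≤ (∑ w ∈ sphere o ch n, ‖pathSum lev par s a w‖ * ‖χ w‖) ^ 2 := by
        gcongr
        exact norm_sum_le_of_le _ fun w _ => (norm_mul _ _).le
    _ ≤ (∑ w ∈ sphere o ch n, ‖pathSum lev par s a w‖ ^ 2) *
        ∑ w ∈ sphere o ch n, ‖χ w‖ ^ 2 := Finset.sum_mul_sq_le_sq_mul_sq _ _ _
    _ ≤ (k : ℝ) ^ lev a * ∑ w ∈ sphere o ch n, ‖χ w‖ ^ 2 := by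
        gcongr

/-- A square-summable solution of `(L - λ) φ = f` is given by the Green function. -/
theorem IsBranching.hasSum_green (h : IsBranching o k lev par ch) {s lam : ℂ}
    (hs : lam * s = k * s ^ 2 + 1) (hs1 : ‖s‖ ^ 2 * k ≤ 1) {φ f : V → ℂ}
    (hφ : Summable fun v => ‖φ v‖ ^ 2) (heq : ∀ v, SolvesAt o par ch lam φ f v)
    (hf : ∀ a, Summable fun w => pathSum lev par s a w * f w) (v : V) :
    HasSum (fun w => green lev par s v w * f w) (φ v) := by
  have hχ : ∀ a, subParent o par s φ a = -s * ∑' w, pathSum lev par s a w * f w := by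
    intro a
    have h1 := (h.hasSum_sphere (hf a).hasSum).const_mul s
    have h2 := h.tendsto_sum_sphere_pathSum hs1 hφ a
    have h3 := h2.sub h1
    have h4 := tendsto_nhds_unique (h3.congr' ?_)
      (tendsto_const_nhds (x := subParent o par s φ a))
    · rw [← h4]
      ring
    · filter_upwards [eventually_ge_atTop (lev a)] with n hn
      rw [h.sum_sphere_pathSum hs heq, if_pos hn]
      ring
  have hsum := (hasSum_sum (s := Finset.range (lev v + 1)) fun i _ =>
    ((hf (par^[i] v)).hasSum.mul_left (s ^ i))).mul_left (-s)
  have hval : -s * ∑ i ∈ Finset.range (lev v + 1),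
      s ^ i * ∑' w, pathSum lev par s (par^[i] v) w * f w = φ v := by
    rw [← h.sum_subParent_iterate s φ _ v rfl, Finset.mul_sum]
    refine Finset.sum_congr rfl fun i _ => ?_
    rw [hχ]
    ring
  rw [hval] at hsum
  refine (congrArg (HasSum · _) (funext fun w => ?_)).mpr hsum
  rw [green, mul_assoc, Finset.sum_mul]
  simp only [mul_assoc]

end Green

/-! ### The determinant in the parameter `s` and its zeros near the thresholds. -/

section Threshold

variable {V : Type u} {o : V} {k : ℕ}

/-- For a potential decaying faster than the tree grows, the values of the parameter `s` for which
`(L - λ) φ = m φ`, `λ s = k s ^ 2 + 1`, has a nonzero square-summable solution are zeros of an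
analytic function which is not identically zero. -/
theorem IsBranching.exists_analytic_determinant {lev : V → ℕ} {par : V → V} {ch : V → Finset V}
    (h : IsBranching o k lev par ch) {m : V → ℂ} {A E : ℝ} (hA : 0 ≤ A) (hE : 0 ≤ E)
    (hkE : k * E < 1) (hm : ∀ v, ‖m v‖ ≤ A * E ^ lev v) :
    ∃ r : ℝ, 1 < r ∧ ∃ D : ℂ → ℂ, DifferentiableOn ℂ D (Metric.ball 0 r) ∧ D 0 ≠ 0 ∧
      ∀ s ∈ Metric.ball (0 : ℂ) r, ‖s‖ ^ 2 * k ≤ 1 → ∀ lam : ℂ, lam * s = k * s ^ 2 + 1 →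
        ∀ φ : V → ℂ, Summable (fun v => ‖φ v‖ ^ 2) → (∃ C, ∀ v, ‖φ v‖ ≤ C) → (∃ v, φ v ≠ 0) →
          (∀ v, SolvesAt o par ch lam φ (fun w => m w * φ w) v) → D s = 0 := by
  obtain ⟨r, hr1, hrq⟩ : ∃ r : ℝ, 1 < r ∧ k * (r ^ 2 * E) < 1 := by
    have hcont : Tendsto (fun r : ℝ => k * (r ^ 2 * E)) (𝓝[>] 1) (𝓝 (k * (1 ^ 2 * E))) :=
      (Continuous.tendsto (by fun_prop) 1).mono_left nhdsWithin_le_nhds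
    obtain ⟨r, hr, hr1⟩ := ((hcont.eventually_lt_const (by simpa using hkE)).and
      self_mem_nhdsWithin).exists
    exact ⟨r, hr1, hr⟩
  have hr0 : 0 < r := one_pos.trans hr1
  -- This weight is the growth of the Green function in `v`. Conjugating by it makes the kernel
  -- bounded in `v` at the cost of a second factor `r ^ lev w`, which explains the condition `k * (r
  -- ^ 2 * E) < 1`.
  let ω : V → ℝ := fun v => ((lev v : ℝ) + 1) * r ^ lev v
  have hω1 : ∀ v, 1 ≤ ω v := fun v =>
    one_le_mul_of_one_le_of_one_le (by simp) (one_le_pow₀ hr1.le)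
  have hω : ∀ v, 0 < ω v := fun v => one_pos.trans_le (hω1 v)
  have hωC : ∀ v, (ω v : ℂ) ≠ 0 := fun v => by exact_mod_cast (hω v).ne'
  let K : ℂ → V → V → ℂ := fun s v w => green lev par s v w * m w * ω w / ω v
  let b : V → ℝ := fun w => r * A * (((lev w : ℝ) + 1) * (r ^ 2 * E) ^ lev w)
  have hb : Summable b := by
    refine h.summable_lev (F := fun n => r * A * (((n : ℝ) + 1) * (r ^ 2 * E) ^ n))
      (fun n => by positivity) ?_
    have hq : ‖(k : ℝ) * (r ^ 2 * E)‖ < 1 := by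
      rwa [Real.norm_of_nonneg (by positivity)]
    have h1 := (summable_pow_mul_geometric_of_norm_lt_one 1 hq).add
      (summable_geometric_of_norm_lt_one hq)
    refine (h1.mul_left (r * A)).congr fun n => ?_
    rw [mul_pow, pow_one]
    ring
  have hK : ∀ s ∈ Metric.ball (0 : ℂ) r, ∀ v w, ‖K s v w‖ ≤ b w := by
    intro s hs v w
    have hs' : ‖s‖ ≤ r := (mem_ball_zero_iff.1 hs).le
    simp only [K, norm_div, norm_mul, Complex.norm_real, Real.norm_of_nonneg (hω _).le]
    rw [div_le_iff₀ (hω v)]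
    calc ‖green lev par s v w‖ * ‖m w‖ * ω w
        ≤ r * (((lev v : ℝ) + 1) * r ^ lev v * r ^ lev w) * (A * E ^ lev w) * ω w := by
          have := h.norm_green_le hr1.le hs' v w
          have := hm w
          have := (hω w).le
          gcongr
      _ = b w * ω v := by
          simp only [b, ω, mul_pow, ← pow_mul]
          ring
  obtain ⟨D, hD, hD0, hDz⟩ := RegularTree.exists_analytic_determinant (K := K)
    Metric.isOpen_ball (Metric.mem_ball_self hr0) hb hK
    (fun v w => ((((differentiable_green v w).mul_const _).mul_const _).div_const
      _).differentiableOn) (fun v w => by simp [K, green])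
  refine ⟨r, hr1, D, hD, hD0, fun s hs hs1 lam hlam φ hφ ⟨C, hC⟩ ⟨v₀, hv₀⟩ heq => ?_⟩
  have hs' : ‖s‖ ≤ r := (mem_ball_zero_iff.1 hs).le
  have hf : ∀ a, Summable fun w => pathSum lev par s a w * (m w * φ w) := by
    intro a
    have hC0 : 0 ≤ C := (norm_nonneg _).trans (hC v₀)
    have h1 : Summable fun w => A * C * (r * E) ^ lev w := by
      refine h.summable_lev (F := fun n => A * C * (r * E) ^ n) (fun n => by positivity) ?_
      have hle : k * (r * E) ≤ k * (r ^ 2 * E) := by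
        gcongr
        exact le_self_pow₀ hr1.le two_ne_zero
      have hq : ‖(k : ℝ) * (r * E)‖ < 1 := by
        rw [Real.norm_of_nonneg (by positivity)]
        exact hle.trans_lt hrq
      refine ((summable_geometric_of_norm_lt_one hq).mul_left (A * C)).congr fun n => ?_
      rw [mul_pow]
      ring
    refine Summable.of_norm_bounded h1 fun w => ?_
    rw [norm_mul, norm_mul]
    calc ‖pathSum lev par s a w‖ * (‖m w‖ * ‖φ w‖) ≤ r ^ lev w * (A * E ^ lev w * C) := by
          have := h.norm_pathSum_le hr1.le hs' a w
          have := hm w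
          have := hC w
          gcongr
      _ = A * C * (r * E) ^ lev w := by
          rw [mul_pow]
          ring
  -- The conjugated unknown stays bounded because `ω ≥ 1`.
  refine hDz s hs (fun v => φ v / ω v) ⟨C, fun v => ?_⟩ ⟨v₀, div_ne_zero hv₀ (hωC v₀)⟩
    fun v => ?_
  · rw [norm_div, Complex.norm_real, Real.norm_of_nonneg (hω v).le]
    exact (div_le_self (norm_nonneg _) (hω1 v)).trans (hC v)
  · have hg := (h.hasSum_green hlam hs1 hφ heq hf v).div_const (ω v : ℂ)
    rw [← hg.tsum_eq]
    refine tsum_congr fun w => ?_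
    simp only [K]
    field_simp [hωC w, hωC v]

/-- Take `E = exp (-δ)`; the decay enters only through `log k < δ`. The root term lives at level
`0`, where `E ^ 0 = 1`, so it only adds `1` to the constant. -/
theorem DecayAssumption.exists_geometric_bound {G : SimpleGraph V} {M : V → ℂ} (hk : 1 ≤ k)
    (hM : DecayAssumption G o k M) : ∃ A E : ℝ, 0 ≤ A ∧ 0 ≤ E ∧ k * E < 1 ∧
      ∀ v, ‖modifiedPotential o M v‖ ≤ A * E ^ G.dist o v := by
  obtain ⟨C, δ, hδ, hC⟩ := hM
  have hk0 : (0 : ℝ) < k := by exact_mod_cast hk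
  have hlog : Real.log k < δ := by
    split_ifs at hδ with h1
    · simpa [h1] using hδ
    · have : (1 : ℝ) < k := by exact_mod_cast lt_of_le_of_ne hk (Ne.symm h1)
      have := Real.log_pos this
      linarith
  refine ⟨|C| + 1, Real.exp (-δ), by positivity, (Real.exp_pos _).le, ?_, fun v => ?_⟩
  · calc k * Real.exp (-δ) = Real.exp (Real.log k - δ) := by
          rw [sub_eq_add_neg, Real.exp_add, Real.exp_log hk0]
      _ < 1 := Real.exp_lt_one_iff.2 (by linarith)
  · have hexp : Real.exp (-δ * G.dist o v) = Real.exp (-δ) ^ G.dist o v := by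
      rw [← Real.exp_nat_mul]
      congr 1
      ring
    have h1 : ‖M v‖ ≤ |C| * Real.exp (-δ) ^ G.dist o v := by
      rw [← hexp]
      refine (hC v).trans ?_
      gcongr
      exact le_abs_self C
    have h2 : ‖rootIndicator o v‖ ≤ 1 * Real.exp (-δ) ^ G.dist o v := by
      rw [rootIndicator]
      split_ifs with hv
      · simp [hv]
      · simp only [norm_zero]
        positivity
    rw [modifiedPotential, add_mul, add_comm (|C| * _)]
    refine (norm_add_le _ _).trans (add_le_add ?_ h1)
    rwa [norm_neg]

/-- The two roots of `k s ^ 2 - lam s + 1` have product `1 / k`; the one of smaller modulus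
qualifies. -/
theorem exists_small_root (hk : 1 ≤ k) (lam : ℂ) :
    ∃ s : ℂ, lam * s = k * s ^ 2 + 1 ∧ ‖s‖ ^ 2 * k ≤ 1 := by
  have hk0 : (k : ℂ) ≠ 0 := by exact_mod_cast (by omega : k ≠ 0)
  obtain ⟨d, hd⟩ := IsAlgClosed.exists_pow_nat_eq (lam ^ 2 - 4 * k) two_pos
  set s₁ := (lam + d) / (2 * k)
  set s₂ := (lam - d) / (2 * k)
  have h1 : lam * s₁ = k * s₁ ^ 2 + 1 := by
    simp only [s₁]
    field_simp
    linear_combination -hd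
  have h2 : lam * s₂ = k * s₂ ^ 2 + 1 := by
    simp only [s₂]
    field_simp
    linear_combination -hd
  have h12 : k * (s₁ * s₂) = 1 := by
    simp only [s₁, s₂]
    field_simp
    linear_combination -hd
  have hn : (k : ℝ) * (‖s₁‖ * ‖s₂‖) = 1 := by
    simpa using congrArg norm h12
  rcases le_total ‖s₁‖ ‖s₂‖ with hle | hle
  · refine ⟨s₁, h1, ?_⟩
    calc ‖s₁‖ ^ 2 * k = k * (‖s₁‖ * ‖s₁‖) := by ring
      _ ≤ k * (‖s₁‖ * ‖s₂‖) := by gcongr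
      _ = 1 := hn
  · refine ⟨s₂, h2, ?_⟩
    calc ‖s₂‖ ^ 2 * k = k * (‖s₂‖ * ‖s₂‖) := by ring
      _ ≤ k * (‖s₁‖ * ‖s₂‖) := by gcongr
      _ = 1 := hn

theorem norm_le_one_of_norm_sq_mul_le (hk : 1 ≤ k) {s : ℂ} (hs : ‖s‖ ^ 2 * k ≤ 1) :
    ‖s‖ ≤ 1 := by
  have hk' : (1 : ℝ) ≤ k := by exact_mod_cast hk
  have h1 : ‖s‖ ^ 2 * 1 ≤ 1 := le_trans (by gcongr) hs
  exact (pow_le_one_iff_of_nonneg (norm_nonneg s) two_ne_zero).1 (by linarith)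

theorem not_accumulatesAt_threshold {G : SimpleGraph V} [G.LocallyFinite] (hk : 1 ≤ k)
    (hG : IsRegularRootedTree G o k) (M : V → ℂ) (hM : DecayAssumption G o k M) {s₀ : ℂ}
    (hs₀ : k * s₀ ^ 2 = 1) {ν : ℕ → ℂ} (hν : ∀ j, IsEigenvalue (schrodinger hG M hM.bdd) (ν j)) :
    ¬ AccumulatesAt ν (k + 1 - 2 * k * s₀) := by
  classical
  intro hacc
  have hk' : (1 : ℝ) ≤ k := by exact_mod_cast hk
  obtain ⟨par, ch, hB, hnb⟩ := hG.exists_branching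
  obtain ⟨A, E, hA, hE, hkE, hm⟩ := hM.exists_geometric_bound hk
  obtain ⟨r, hr, D, hD, hD0, hDz⟩ := hB.exists_analytic_determinant hA hE hkE hm
  have han : AnalyticOnNhd ℂ D (Metric.ball 0 r) := hD.analyticOnNhd Metric.isOpen_ball
  have hball : ∀ s : ℂ, ‖s‖ ^ 2 * k ≤ 1 → s ∈ Metric.ball (0 : ℂ) r := fun s hs =>
    mem_ball_zero_iff.2 ((norm_le_one_of_norm_sq_mul_le hk hs).trans_lt hr)
  have hs₀n : ‖s₀‖ ^ 2 * k ≤ 1 := by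
    have := congrArg norm hs₀
    simp only [norm_mul, norm_pow, Complex.norm_natCast, norm_one] at this
    rw [mul_comm, this]
  -- Otherwise `D` would vanish on the whole disc by the identity theorem, against `D 0 ≠ 0`.
  have hiso : ∀ᶠ s in 𝓝[≠] s₀, D s ≠ 0 := by
    refine ((han s₀ (hball s₀ hs₀n)).eventually_eq_zero_or_eventually_ne_zero).resolve_left
      fun h0 => hD0 ?_
    exact han.eqOn_zero_of_preconnected_of_eventuallyEq_zero
      (convex_ball 0 r).isPreconnected (hball s₀ hs₀n) h0
      (Metric.mem_ball_self (one_pos.trans hr))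
  obtain ⟨η, hη, hηD⟩ := Metric.eventually_nhds_iff.1 (eventually_nhdsWithin_iff.1 hiso)
  -- Radius `η ^ 2`, since `s - s₀` behaves like a square root of the distance to the threshold.
  obtain ⟨z, hzt, hz, j, rfl⟩ := (Metric.nhds_basis_ball.frequently_iff.1
    (accPt_iff_frequently.1 hacc)) (i := η ^ 2) (by positivity)
  obtain ⟨φ, hφ⟩ := (hν j).exists_hasEigenvector
  obtain ⟨s, hs, hsn⟩ := exists_small_root hk ((k : ℂ) + 1 - ν j)
  -- Completing the square with `k * s₀ ^ 2 = 1`. This gives both `s ≠ s₀` and the closeness of `s`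
  -- to `s₀`.
  have hsq : k * (s - s₀) ^ 2 = s * (k + 1 - 2 * k * s₀ - ν j) := by
    linear_combination hs₀ - hs
  have hss₀ : s ≠ s₀ := by
    rintro rfl
    rw [sub_self, zero_pow two_ne_zero, mul_zero, eq_comm, mul_eq_zero] at hsq
    rcases hsq with h0 | h0
    · simp [h0] at hs₀
    · exact hz (sub_eq_zero.1 h0).symm
  have hclose : dist s s₀ < η := by
    rw [dist_eq_norm]
    refine lt_of_pow_lt_pow_left₀ 2 hη.le ?_
    have h1 := congrArg norm hsq
    rw [norm_mul, norm_mul, norm_pow, Complex.norm_natCast] at h1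
    calc ‖s - s₀‖ ^ 2 ≤ k * ‖s - s₀‖ ^ 2 := le_mul_of_one_le_left (by positivity) hk'
      _ = ‖s‖ * ‖(k + 1 - 2 * k * s₀ - ν j : ℂ)‖ := h1
      _ ≤ 1 * ‖(k + 1 - 2 * k * s₀ - ν j : ℂ)‖ := by
        gcongr
        exact norm_le_one_of_norm_sq_mul_le hk hsn
      _ < η ^ 2 := by
        rw [one_mul, ← dist_eq_norm, dist_comm]
        exact hzt
  refine hηD hclose hss₀ (hDz s (hball s hsn) hsn _ hs φ ?_ ?_ ?_ fun v => ?_)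
  · have := (lp.memℓp φ).summable (by norm_num)
    simpa using this
  · exact ⟨‖φ‖, fun v => lp.norm_apply_le_norm two_ne_zero φ v⟩
  · by_contra! h0
    exact hφ.2 (lp.ext (funext h0))
  · have hev : schrodinger hG M hM.bdd φ = ν j • φ := hφ.apply_eq_smul
    have hv : -(∑ w ∈ G.neighborFinset v, φ w) + ((k : ℂ) + 1) * φ v +
        modifiedPotential o M v * φ v = ν j * φ v := congrArg (fun f : L2 V => f v) hev
    rw [SolvesAt]
    by_cases hvo : v = o
    · subst hvo
      rw [(hnb φ v).1] at hv
      rw [if_pos rfl]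
      linear_combination -hv
    · rw [(hnb φ v).2 hvo] at hv
      rw [if_neg hvo]
      linear_combination -hv

end Threshold

end RegularTree

theorem corollary1 {V : Type*} (G : SimpleGraph V) [G.LocallyFinite] (o : V) (k : ℕ) (hk : 1 ≤ k)
    (hG : RegularTree.IsRegularRootedTree G o k) (M : V → ℂ)
    (hM : RegularTree.DecayAssumption G o k M) :
    (¬ ∃ ν : ℕ → ℂ,
      (∀ j, RegularTree.IsEigenvalue (RegularTree.schrodinger hG M hM.bdd) (ν j)) ∧
        RegularTree.AccumulatesAt ν (RegularTree.tMinus k : ℂ)) ∧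
    (¬ ∃ ν : ℕ → ℂ,
      (∀ j, RegularTree.IsEigenvalue (RegularTree.schrodinger hG M hM.bdd) (ν j)) ∧
        RegularTree.AccumulatesAt ν (RegularTree.tPlus k : ℂ)) := by
  have hsq : ((Real.sqrt k : ℝ) : ℂ) ^ 2 = k := by
    rw [← Complex.ofReal_pow, Real.sq_sqrt (Nat.cast_nonneg k), Complex.ofReal_natCast]
  have hk0 : (k : ℂ) ≠ 0 := by exact_mod_cast (by omega : k ≠ 0)
  -- The double roots `s₀ = ±√k / k` turn `k + 1 - 2 * k * s₀` into the lower and upper threshold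
  -- respectively.
  have h1 : (k : ℂ) * ((Real.sqrt k : ℝ) / k : ℂ) ^ 2 = 1 := by
    rw [div_pow, hsq]
    field_simp
  have h2 : (k : ℂ) * (-((Real.sqrt k : ℝ) / k : ℂ)) ^ 2 = 1 := by
    rw [neg_sq, h1]
  constructor
  · rintro ⟨ν, hν, hacc⟩
    refine RegularTree.not_accumulatesAt_threshold hk hG M hM h1 hν ?_
    convert hacc using 1
    rw [RegularTree.tMinus]
    push_cast
    field_simp
    ring
  · rintro ⟨ν, hν, hacc⟩
    refine RegularTree.not_accumulatesAt_threshold hk hG M hM h2 hν ?_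
    convert hacc using 1
    rw [RegularTree.tPlus]
    push_cast
    field_simp
    ring
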